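/- **Setting.** Let $\mathcal D$ be a measurable space of databases in which singletons are measurable, with a symmetric neighbouring relation for which at least one pair of distinct databases are neighbours. A mechanism $M$ (assigning to each database a probability law on a measurable output space) is $\varepsilon$-DP if $M(D)(S)\le e^{\varepsilon}M(D')(S)$ for all neighbours $D,D'$ and all measurable $S$. *Regions.* For probability measures $P,Q$ on the same space, let $f_{P,Q}(t)=\inf\{\beta_{\mathrm{II}}(\varphi) : \beta_{\mathrm I}(\varphi)\le t\}$ be the trade-off function of testing $P$ (null) against $Q$ (alternative), where the infimum is over measurable randomized rejection rules $\varphi:\Omega\to[0,1]$, $\beta_{\mathrm I}(\varphi)=\int\varphi\,dP$ and $\beta_{\mathrm{II}}(\varphi)=\int(1-\varphi)\,dQ$. For a function $f$ on $[0,1]$ put $\mathcal R_f=\{(\beta_{\mathrm I},\beta_{\mathrm{II}}) : 0\le\beta_{\mathrm I}\le 1,\ f(\beta_{\mathrm I})\le\beta_{\mathrm{II}}\le 1-\beta_{\mathrm I}\}$. The privacy region of the pair $(P,Q)$ is $\mathcal R_{f_{P,Q}}$. The region of the $(\varepsilon,\delta)$ constraint is $\mathcal R(\varepsilon,\delta)=\mathcal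 R_{f_{\varepsilon,\delta}}$ with $f_{\varepsilon,\delta}(t)=\max\{0,\,1-\delta-e^{\varepsilon}t,\,e^{-\varepsilon}(1-\delta-t)\}$. *Composition.* An adaptive composition at levels $(\eta_1,\dots,\eta_k)$ is the following experiment with a hidden bit $c\in\{0,1\}$. An adversary draws private randomness. In round $i$ it selects, as measurable functions of its current view (the randomness and all previous responses), an $\eta_i$-DP mechanism and a pair of neighbouring databases $D_0,D_1$, and receives the output of the mechanism on $D_c$. If $P_0$ and $P_1$ denote the laws of the final view under $c=0$ and $c=1$, the privacy region of the composition is that of $(P_0,P_1)$. *Randomized response.* $\varepsilon$-binary randomized response reports the bit $c$ with probability $\frac{e^{\varepsilon}}{e^{\varepsilon}+1}$ and the opposite bit with probability $\frac1{e^{\varepsilon}+1}$. **Theorem.** Let $\varepsilon_1>0$, $\varepsilon_2\ge0$ and let $x,y\ge 0$ be integers. Let $(\eta_1,\dots,\eta_{x+y})$ be any sequence in which $x$ positions carry the level $\varepsilon_1$ and the other $y$ positions carry the level $\varepsilon_2$. For integers $0\le a^*\le x$, $0\le b^*\le y$ put $$\varepsilon_{a^*,b^*}=\varepsilon_1(x-2a^*)+\varepsilon_2(y-2b^*),\qquad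 S=\{(a^*,b^*) : 0\le a^*\le x,\ 0\le b^*\le y,\ \varepsilon_{a^*,b^*}\ge0\},$$ $$\delta_{a^*,b^*}=\Big(\tfrac1{e^{\varepsilon_1}+1}\Big)^{x}\Big(\tfrac1{e^{\varepsilon_2}+1}\Big)^{y}\sum_{b=0}^{y}\ \sum_{a=a_0(b)}^{x}\binom xa\binom yb\Big(e^{a\varepsilon_1+b\varepsilon_2}-e^{\varepsilon_1(2(x-a^*)-a)+\varepsilon_2(2(y-b^*)-b)}\Big),$$ $$a_0(b)=\max\Big(0,\Big\lceil (y-b^*-b)\tfrac{\varepsilon_2}{\varepsilon_1}+(x-a^*)\Big\rceil\Big),$$ where a sum whose lower limit exceeds its upper limit is $0$, and let $$\mathcal R^*=\bigcap_{(a^*,b^*)\in S}\mathcal R(\varepsilon_{a^*,b^*},\delta_{a^*,b^*}).$$ Then: 1. the union of the privacy regions of all adaptive compositions at levels $(\eta_1,\dots,\eta_{x+y})$ equals $\mathcal R^*$; in particular the privacy region of every such composition is contained in $\mathcal R^*$; 2. the composition of independent binary randomized responses at these levels is such an adaptive composition, and its privacy region is exactly $\mathcal R^*$. -/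

import Mathlib

open MeasureTheory ProbabilityTheory

universe u v

namespace HetDP

noncomputable section

/-- The trade-off function of testing `P` (null) against `Q` (alternative): the least type-II error
of a (possibly randomized) rejection rule `φ` with type-I error at most `t`. Here `φ ω` is the
probability with which the null hypothesis is rejected on observing `ω`. -/
def tradeOff {Ω : Type u} [MeasurableSpace Ω] (P Q : Measure Ω) (t : ℝ) : ℝ :=
  sInf {β : ℝ | ∃ φ : Ω → ℝ, Measurable φ ∧ (∀ ω, φ ω ∈ Set.Icc (0 : ℝ) 1) ∧
    ∫ ω, φ ω ∂P ≤ t ∧ β = ∫ ω, (1 - φ ω) ∂Q}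

/-- The region of error pairs `(β_I, β_II)` lying on or above the curve of `f` and on or below
the diagonal `β_I + β_II = 1`. -/
def tradeOffRegion (f : ℝ → ℝ) : Set (ℝ × ℝ) :=
  {p | p.1 ∈ Set.Icc (0 : ℝ) 1 ∧ f p.1 ≤ p.2 ∧ p.2 ≤ 1 - p.1}

/-- The privacy region of the binary hypothesis test `P` against `Q`. -/
def privacyRegion {Ω : Type u} [MeasurableSpace Ω] (P Q : Measure Ω) : Set (ℝ × ℝ) :=
  tradeOffRegion (tradeOff P Q)

/-- The trade-off function of the `(ε, δ)` constraint; above it one has `0 ≤ β_II`,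
`1 - δ ≤ exp ε * β_I + β_II` and `1 - δ ≤ β_I + exp ε * β_II`. -/
def dpTradeOff (ε δ t : ℝ) : ℝ :=
  max 0 (max (1 - δ - Real.exp ε * t) (Real.exp (-ε) * (1 - δ - t)))

/-- `(ε, δ)`-differential privacy of the mechanism `M`, for the neighbouring relation `adj`. -/
def IsDP {𝒟 : Type v} {Y : Type u} [MeasurableSpace Y] (adj : 𝒟 → 𝒟 → Prop) (ε δ : ℝ)
    (M : 𝒟 → Measure Y) : Prop :=
  ∀ D D' : 𝒟, adj D D' → ∀ S : Set Y, MeasurableSet S →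
    M D S ≤ ENNReal.ofReal (Real.exp ε) * M D' S + ENNReal.ofReal δ

/-- `IsAdaptiveComposition adj l H P₀ P₁` : `P₀` and `P₁` are the laws of an adversary's view,
with values in `H`, in an adaptive composition experiment with hidden bit `0` resp. `1`.
The adversary first draws private randomness. In each round, as measurable functions of the current
view, it selects a mechanism and two neighbouring databases `D₀ h`, `D₁ h`, and appends to its view
the response of the mechanism on the database singled out by the hidden bit. The mechanism used in
a round is `ε`-differentially private, for every current view `h`. The list `l` records the privacy
levels of the rounds, the most recent one first. -/
inductive IsAdaptiveComposition {𝒟 : Type v} [MeasurableSpace 𝒟] (adj : 𝒟 → 𝒟 → Prop) :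
    List ℝ → (H : Type u) → [MeasurableSpace H] → Measure H → Measure H → Prop
  | start (R : Type u) [MeasurableSpace R] (ρ : Measure R) [IsProbabilityMeasure ρ] :
      IsAdaptiveComposition adj [] R ρ ρ
  | round (l : List ℝ) (ε : ℝ) (H : Type u) [MeasurableSpace H] (P₀ P₁ : Measure H)
      (hl : IsAdaptiveComposition adj l H P₀ P₁)
      (Y : Type u) [MeasurableSpace Y] (M : Kernel (H × 𝒟) Y) [IsMarkovKernel M]
      (hM : ∀ h : H, IsDP adj ε 0 (fun D => M (h, D)))
      (D₀ D₁ : H → 𝒟) (hD₀ : Measurable D₀) (hD₁ : Measurable D₁)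
      (hadj : ∀ h : H, adj (D₀ h) (D₁ h)) :
      IsAdaptiveComposition adj (ε :: l) (H × Y)
        (P₀ ⊗ₘ M.comap (fun h => (h, D₀ h)) (measurable_id.prodMk hD₀))
        (P₁ ⊗ₘ M.comap (fun h => (h, D₁ h)) (measurable_id.prodMk hD₁))

/-- The privacy region of adaptive composition at privacy levels `l`: all error pairs that
belong to the privacy region of some adaptive composition of mechanisms with these levels. -/
def compositionRegion {𝒟 : Type v} [MeasurableSpace 𝒟] (adj : 𝒟 → 𝒟 → Prop) (l : List ℝ) :
    Set (ℝ × ℝ) :=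
  {p | ∃ (H : Type) (_ : MeasurableSpace H) (P₀ P₁ : Measure H),
    IsAdaptiveComposition adj l H P₀ P₁ ∧ p ∈ privacyRegion P₀ P₁}

/-- Binary randomized response: reports the bit `b` with probability `exp ε / (exp ε + 1)`
and the opposite bit with probability `1 / (exp ε + 1)`. -/
def randomizedResponse (ε : ℝ) (b : Bool) : Measure Bool :=
  ENNReal.ofReal (Real.exp ε / (Real.exp ε + 1)) • Measure.dirac b +
    ENNReal.ofReal (1 / (Real.exp ε + 1)) • Measure.dirac (!b)

/-- The space of outputs of independent randomized responses at levels `l`. -/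
def RRView : List ℝ → Type
  | [] => Unit
  | _ :: l => RRView l × Bool

/-- The product σ-algebra. -/
instance instMeasurableSpaceRRView : (l : List ℝ) → MeasurableSpace (RRView l)
  | [] => inferInstanceAs (MeasurableSpace Unit)
  | _ :: l => @Prod.instMeasurableSpace (RRView l) Bool (instMeasurableSpaceRRView l) _

/-- The joint law of independent randomized responses at levels `l`, all applied to the bit `b`. -/
def rrLaw (b : Bool) : (l : List ℝ) → Measure (RRView l)
  | [] => Measure.dirac ()
  | ε :: l => (rrLaw b l).prod (randomizedResponse ε b)

/-- The exponent `ε₁ (x - 2 a) + ε₂ (y - 2 b)`. -/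
def hetEps (ε₁ ε₂ : ℝ) (x y a b : ℕ) : ℝ :=
  ε₁ * ((x : ℝ) - 2 * a) + ε₂ * ((y : ℝ) - 2 * b)

/-- The index set `{(a, b) ∈ {0, …, x} × {0, …, y} | ε₁ (x - 2 a) + ε₂ (y - 2 b) ≥ 0}`. -/
def hetIndex (ε₁ ε₂ : ℝ) (x y : ℕ) : Set (ℕ × ℕ) :=
  {q | q.1 ≤ x ∧ q.2 ≤ y ∧ 0 ≤ hetEps ε₁ ε₂ x y q.1 q.2}

/-- The summation bound `max (0, ⌈(y - b - j) ε₂ / ε₁ + (x - a)⌉)`; `⌈·⌉₊` is `0` on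
negative numbers. -/
def hetStart (ε₁ ε₂ : ℝ) (x y a b j : ℕ) : ℕ :=
  ⌈((y : ℝ) - b - j) * (ε₂ / ε₁) + ((x : ℝ) - a)⌉₊

/-- The offset belonging to `(a, b)`. -/
def hetDelta (ε₁ ε₂ : ℝ) (x y a b : ℕ) : ℝ :=
  (1 / (Real.exp ε₁ + 1)) ^ x * (1 / (Real.exp ε₂ + 1)) ^ y *
    ∑ j ∈ Finset.range (y + 1), ∑ i ∈ Finset.Icc (hetStart ε₁ ε₂ x y a b j) x,
      (x.choose i : ℝ) * (y.choose j : ℝ) *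
        (Real.exp (i * ε₁ + j * ε₂) -
          Real.exp (ε₁ * (2 * ((x : ℝ) - a) - i) + ε₂ * (2 * ((y : ℝ) - b) - j)))

/-- The intersection of the regions of all the constraints `(hetEps, hetDelta)`. -/
def hetRegion (ε₁ ε₂ : ℝ) (x y : ℕ) : Set (ℝ × ℝ) :=
  ⋂ q ∈ hetIndex ε₁ ε₂ x y,
    tradeOffRegion (dpTradeOff (hetEps ε₁ ε₂ x y q.1 q.2) (hetDelta ε₁ ε₂ x y q.1 q.2))

end

end HetDP

namespace HetDP

/-- The hockey-stick divergence of order `γ` between the laws of the composed randomized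
responses, as a recursion on the list of levels. -/
noncomputable def rrHockeyStick : List ℝ → ℝ → ℝ
  | [], γ => max 0 (1 - γ)
  | ε :: l, γ => Real.exp ε / (Real.exp ε + 1) * rrHockeyStick l (γ * Real.exp (-ε)) +
      1 / (Real.exp ε + 1) * rrHockeyStick l (γ * Real.exp ε)

theorem rrHockeyStick_perm {l l' : List ℝ} (h : l.Perm l') :
    rrHockeyStick l = rrHockeyStick l' := by
  induction h with
  | nil => rfl
  | cons ε _ ih => funext γ; simp only [rrHockeyStick, ih]
  | swap ε ε' l =>
    funext γ
    simp only [rrHockeyStick]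
    rw [mul_right_comm γ (Real.exp (-ε)), mul_right_comm γ (Real.exp ε) (Real.exp (-ε')),
      mul_right_comm γ (Real.exp (-ε)) (Real.exp ε'), mul_right_comm γ (Real.exp ε) (Real.exp ε')]
    ring
  | trans _ _ ih₁ ih₂ => exact ih₁.trans ih₂

theorem rrHockeyStick_replicate_append (n : ℕ) (ε : ℝ) (l : List ℝ) (γ : ℝ) :
    rrHockeyStick (List.replicate n ε ++ l) γ =
      ∑ i ∈ Finset.HasAntidiagonal.antidiagonal n, (n.choose i.1 : ℝ) *
        ((Real.exp ε / (Real.exp ε + 1)) ^ i.1 * (1 / (Real.exp ε + 1)) ^ i.2 *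
          rrHockeyStick l (γ * Real.exp (ε * ((i.2 : ℝ) - i.1)))) := by
  induction n generalizing γ with
  | zero => simp
  | succ n ih =>
    rw [Finset.sum_antidiagonal_choose_succ_mul (fun i j => (Real.exp ε / (Real.exp ε + 1)) ^ i *
      (1 / (Real.exp ε + 1)) ^ j * rrHockeyStick l (γ * Real.exp (ε * ((j : ℝ) - i))))]
    rw [List.replicate_succ, List.cons_append, rrHockeyStick, ih, ih, Finset.mul_sum,
      Finset.mul_sum, add_comm]
    congr 1
    · refine Finset.sum_congr rfl fun i _ => ?_
      rw [mul_assoc γ, ← Real.exp_add]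
      push_cast
      rw [show ε + ε * ((i.2 : ℝ) - i.1) = ε * ((i.2 : ℝ) + 1 - i.1) by ring]
      ring
    · refine Finset.sum_congr rfl fun i hi => ?_
      rw [mul_assoc γ, ← Real.exp_add]
      rw [Nat.choose_symm_of_eq_add (Finset.HasAntidiagonal.mem_antidiagonal.1 hi).symm]
      push_cast
      rw [show -ε + ε * ((i.2 : ℝ) - i.1) = ε * ((i.2 : ℝ) - (i.1 + 1)) by ring]
      ring

theorem rrHockeyStick_hetEps {ε₁ ε₂ : ℝ} (hε₁ : 0 < ε₁) (x y a b : ℕ) :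
    rrHockeyStick (List.replicate x ε₁ ++ List.replicate y ε₂)
      (Real.exp (hetEps ε₁ ε₂ x y a b)) = hetDelta ε₁ ε₂ x y a b := by
  have hpow : ∀ (ε : ℝ) (i k : ℕ), (Real.exp ε / (Real.exp ε + 1)) ^ i *
      (1 / (Real.exp ε + 1)) ^ k = (1 / (Real.exp ε + 1)) ^ (i + k) * Real.exp (i * ε) := by
    intro ε i k
    rw [Real.exp_nat_mul, div_eq_mul_one_div, mul_pow, pow_add]
    ring
  rw [rrHockeyStick_replicate_append]
  conv_lhs =>
    enter [2, i]
    rw [← List.append_nil (List.replicate y ε₂), rrHockeyStick_replicate_append]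
  unfold hetDelta
  rw [Finset.Nat.sum_antidiagonal_eq_sum_range_succ_mk, Finset.mul_sum]
  simp_rw [Finset.Nat.sum_antidiagonal_eq_sum_range_succ_mk, Finset.mul_sum]
  rw [Finset.sum_comm]
  refine Finset.sum_congr rfl fun j hj => ?_
  have hj' : j ≤ y := Nat.lt_succ_iff.1 (Finset.mem_range.1 hj)
  symm
  have hsub : Finset.Icc (hetStart ε₁ ε₂ x y a b j) x ⊆ Finset.range (x + 1) := fun i hi =>
    Finset.mem_range.2 (Nat.lt_succ_iff.2 (Finset.mem_Icc.1 hi).2)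
  have hle : ∀ i : ℕ, hetStart ε₁ ε₂ x y a b j ≤ i ↔
      ε₁ * (2 * ((x : ℝ) - a) - i) + ε₂ * (2 * ((y : ℝ) - b) - j) ≤ i * ε₁ + j * ε₂ := by
    intro i
    rw [hetStart, Nat.ceil_le, ← mul_le_mul_iff_right₀ hε₁]
    have : ε₁ * (((y : ℝ) - b - j) * (ε₂ / ε₁) + ((x : ℝ) - a)) =
        ((y : ℝ) - b - j) * ε₂ + ε₁ * ((x : ℝ) - a) := by
      field_simp
    rw [this]
    constructor <;> intro h <;> linarith
  have hterm : ∀ i ∈ Finset.range (x + 1),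
      (x.choose i : ℝ) * ((Real.exp ε₁ / (Real.exp ε₁ + 1)) ^ i *
        (1 / (Real.exp ε₁ + 1)) ^ (x - i) * ((y.choose j : ℝ) *
        ((Real.exp ε₂ / (Real.exp ε₂ + 1)) ^ j * (1 / (Real.exp ε₂ + 1)) ^ (y - j) *
        rrHockeyStick [] (Real.exp (hetEps ε₁ ε₂ x y a b) *
          Real.exp (ε₁ * (((x - i : ℕ) : ℝ) - i)) * Real.exp (ε₂ * (((y - j : ℕ) : ℝ) - j)))))) =
      (1 / (Real.exp ε₁ + 1)) ^ x * (1 / (Real.exp ε₂ + 1)) ^ y * ((x.choose i : ℝ) *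
        (y.choose j : ℝ) * max 0 (Real.exp (i * ε₁ + j * ε₂) -
          Real.exp (ε₁ * (2 * ((x : ℝ) - a) - i) + ε₂ * (2 * ((y : ℝ) - b) - j)))) := by
    intro i hi
    have hi' : i ≤ x := Nat.lt_succ_iff.1 (Finset.mem_range.1 hi)
    rw [hpow, hpow, Nat.add_sub_cancel' hi', Nat.add_sub_cancel' hj']
    have hmax : max 0 (Real.exp (i * ε₁ + j * ε₂) -
          Real.exp (ε₁ * (2 * ((x : ℝ) - a) - i) + ε₂ * (2 * ((y : ℝ) - b) - j))) =
        Real.exp (i * ε₁) * Real.exp (j * ε₂) * rrHockeyStick [] (Real.exp (hetEps ε₁ ε₂ x y a b) *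
          Real.exp (ε₁ * (((x - i : ℕ) : ℝ) - i)) * Real.exp (ε₂ * (((y - j : ℕ) : ℝ) - j))) := by
      rw [rrHockeyStick, mul_max_of_nonneg _ _ (by positivity), mul_zero,
        mul_sub (Real.exp _ * _), mul_one]
      simp only [← Real.exp_add, hetEps, Nat.cast_sub hi', Nat.cast_sub hj']
      ring_nf
    rw [hmax]
    ring
  refine Eq.trans ?_ (Finset.sum_congr rfl hterm).symm
  rw [← Finset.sum_subset hsub]
  · refine Finset.sum_congr rfl fun i hi => ?_
    rw [max_eq_right]
    exact sub_nonneg.2 (Real.exp_le_exp.2 ((hle i).1 (Finset.mem_Icc.1 hi).1))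
  · intro i hi hi'
    have hlt : ¬ hetStart ε₁ ε₂ x y a b j ≤ i := fun h =>
      hi' (Finset.mem_Icc.2 ⟨h, Nat.lt_succ_iff.1 (Finset.mem_range.1 hi)⟩)
    rw [hle, not_le] at hlt
    rw [max_eq_left (sub_nonpos.2 (Real.exp_le_exp.2 hlt.le))]
    ring

theorem IsAdaptiveComposition.symm {𝒟 : Type v} [MeasurableSpace 𝒟] {adj : 𝒟 → 𝒟 → Prop}
    (hsymm : ∀ D D' : 𝒟, adj D D' → adj D' D) {l : List ℝ} {H : Type u} [mH : MeasurableSpace H]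
    {P₀ P₁ : Measure H} (h : IsAdaptiveComposition adj l H P₀ P₁) :
    IsAdaptiveComposition adj l H P₁ P₀ := by
  induction h with
  | start R ρ => exact .start R ρ
  | round l ε H P₀ P₁ _ Y M hM D₀ D₁ hD₀ hD₁ hadj ih =>
    exact .round l ε H P₁ P₀ ih Y M hM D₁ D₀ hD₁ hD₀ fun h => hsymm _ _ (hadj h)

theorem IsAdaptiveComposition.isProbabilityMeasure {𝒟 : Type v} [MeasurableSpace 𝒟]
    {adj : 𝒟 → 𝒟 → Prop} {l : List ℝ} {H : Type u} [mH : MeasurableSpace H]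
    {P₀ P₁ : Measure H} (h : IsAdaptiveComposition adj l H P₀ P₁) :
    IsProbabilityMeasure P₀ ∧ IsProbabilityMeasure P₁ := by
  induction h with
  | start R ρ => exact ⟨inferInstance, inferInstance⟩
  | round l ε H P₀ P₁ _ Y M hM D₀ D₁ hD₀ hD₁ hadj ih =>
    have := ih.1
    have := ih.2
    exact ⟨inferInstance, inferInstance⟩

theorem integrable_of_mem_Icc {Ω : Type*} [MeasurableSpace Ω] {μ : Measure Ω} [IsFiniteMeasure μ]
    {φ : Ω → ℝ} (hφ : Measurable φ) (h : ∀ ω, φ ω ∈ Set.Icc (0 : ℝ) 1) : Integrable φ μ :=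
  Integrable.of_mem_Icc 0 1 hφ.aemeasurable (.of_forall h)

theorem integral_mem_Icc {Ω : Type*} [MeasurableSpace Ω] {μ : Measure Ω} [IsProbabilityMeasure μ]
    {φ : Ω → ℝ} (hφ : Measurable φ) (h : ∀ ω, φ ω ∈ Set.Icc (0 : ℝ) 1) :
    ∫ ω, φ ω ∂μ ∈ Set.Icc (0 : ℝ) 1 := by
  refine ⟨integral_nonneg fun ω => (h ω).1, ?_⟩
  have := integral_mono (integrable_of_mem_Icc hφ h) (integrable_const (1 : ℝ))
    (fun ω => (h ω).2) (μ := μ)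
  simpa using this

theorem integral_one_sub {Ω : Type*} [MeasurableSpace Ω] {μ : Measure Ω} [IsProbabilityMeasure μ]
    {φ : Ω → ℝ} (hφ : Measurable φ) (h : ∀ ω, φ ω ∈ Set.Icc (0 : ℝ) 1) :
    ∫ ω, (1 - φ ω) ∂μ = 1 - ∫ ω, φ ω ∂μ := by
  rw [integral_sub (integrable_const _) (integrable_of_mem_Icc hφ h)]
  simp

theorem IsDP.integral_le {𝒟 : Type v} {Y : Type u} [MeasurableSpace Y] {adj : 𝒟 → 𝒟 → Prop}
    {ε : ℝ} {M : 𝒟 → Measure Y} [∀ D, IsProbabilityMeasure (M D)] (hM : IsDP adj ε 0 M) {D D' : 𝒟}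
    (hD : adj D D') {φ : Y → ℝ} (hφ : Measurable φ) (h : ∀ y, φ y ∈ Set.Icc (0 : ℝ) 1) :
    ∫ y, φ y ∂(M D) ≤ Real.exp ε * ∫ y, φ y ∂(M D') := by
  have hle : M D ≤ ENNReal.ofReal (Real.exp ε) • M D' := by
    refine Measure.le_iff.2 fun S hS => ?_
    simpa using hM D D' hD S hS
  have := integral_mono_measure hle (.of_forall fun y => (h y).1)
    ((integrable_of_mem_Icc hφ h).smul_measure ENNReal.ofReal_ne_top)
  rwa [integral_smul_measure, ENNReal.toReal_ofReal (Real.exp_pos ε).le, smul_eq_mul] at this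

/-- A pair of rejection probabilities compatible with `ε`-differential privacy arises from
post-processing `ε`-binary randomized response. -/
theorem exists_eq_randomizedResponse {ε : ℝ} (hε : 0 ≤ ε) :
    ∃ c d c' d' : ℝ, ∀ u v : ℝ, u ∈ Set.Icc (0 : ℝ) 1 → u ≤ Real.exp ε * v → v ≤ Real.exp ε * u →
      1 - u ≤ Real.exp ε * (1 - v) → 1 - v ≤ Real.exp ε * (1 - u) →
      c * u + d * v ∈ Set.Icc (0 : ℝ) 1 ∧ c' * u + d' * v ∈ Set.Icc (0 : ℝ) 1 ∧
      u = Real.exp ε / (Real.exp ε + 1) * (c * u + d * v) +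
        1 / (Real.exp ε + 1) * (c' * u + d' * v) ∧
      v = 1 / (Real.exp ε + 1) * (c * u + d * v) +
        Real.exp ε / (Real.exp ε + 1) * (c' * u + d' * v) := by
  rcases hε.eq_or_lt with rfl | hε
  · refine ⟨1, 0, 1, 0, fun u v hu h₁ h₂ _ _ => ?_⟩
    rw [Real.exp_zero] at *
    have : u = v := le_antisymm (by linarith) (by linarith)
    subst this
    simp only [one_mul, zero_mul, add_zero]
    refine ⟨hu, hu, ?_, ?_⟩ <;> ring
  · have he : 0 < Real.exp ε - 1 := sub_pos.2 (Real.one_lt_exp_iff.2 hε)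
    set e := Real.exp ε
    refine ⟨e / (e - 1), -1 / (e - 1), -1 / (e - 1), e / (e - 1),
      fun u v hu h₁ h₂ h₃ h₄ => ⟨⟨?_, ?_⟩, ⟨?_, ?_⟩, ?_, ?_⟩⟩
    · rw [show e / (e - 1) * u + -1 / (e - 1) * v = (e * u - v) / (e - 1) by ring]
      exact div_nonneg (by linarith) he.le
    · rw [show e / (e - 1) * u + -1 / (e - 1) * v = (e * u - v) / (e - 1) by ring, div_le_one he]
      linarith
    · rw [show -1 / (e - 1) * u + e / (e - 1) * v = (e * v - u) / (e - 1) by ring]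
      exact div_nonneg (by linarith) he.le
    · rw [show -1 / (e - 1) * u + e / (e - 1) * v = (e * v - u) / (e - 1) by ring, div_le_one he]
      linarith
    all_goals
      have h1 : e - 1 ≠ 0 := he.ne'
      have h2 : e + 1 ≠ 0 := by linarith
      field_simp
      ring

theorem IsAdaptiveComposition.integral_sub_le {𝒟 : Type v} [MeasurableSpace 𝒟]
    {adj : 𝒟 → 𝒟 → Prop} (hsymm : ∀ D D' : 𝒟, adj D D' → adj D' D) {l : List ℝ}
    {H : Type u} [mH : MeasurableSpace H]
    {P₀ P₁ : Measure H} (h : IsAdaptiveComposition adj l H P₀ P₁) (hl : ∀ ε ∈ l, 0 ≤ ε)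
    {φ : H → ℝ} (hφ : Measurable φ) (hφ' : ∀ ω, φ ω ∈ Set.Icc (0 : ℝ) 1) {γ : ℝ} :
    ∫ ω, φ ω ∂P₀ - γ * ∫ ω, φ ω ∂P₁ ≤ rrHockeyStick l γ := by
  induction h generalizing γ with
  | start R ρ =>
    have h := integral_mem_Icc (μ := ρ) hφ hφ'
    rw [rrHockeyStick]
    rcases le_total γ 1 with hγ | hγ
    · exact le_max_of_le_right (by nlinarith [h.1, h.2])
    · exact le_max_of_le_left (by nlinarith [h.1, h.2])
  | round l ε H P₀ P₁ hP Y M hM D₀ D₁ hD₀ hD₁ hadj ih =>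
    have := hP.isProbabilityMeasure.1
    have := hP.isProbabilityMeasure.2
    have hε : 0 ≤ ε := hl ε (by simp)
    set K₀ := M.comap (fun h => (h, D₀ h)) (measurable_id.prodMk hD₀) with hK₀
    set K₁ := M.comap (fun h => (h, D₁ h)) (measurable_id.prodMk hD₁) with hK₁
    set U : H → ℝ := fun h => ∫ y, φ (h, y) ∂(K₀ h) with hU
    set V : H → ℝ := fun h => ∫ y, φ (h, y) ∂(K₁ h) with hV
    have hUm : Measurable U := (hφ.stronglyMeasurable.integral_kernel_prod_right' (κ := K₀)).measurable
    have hVm : Measurable V := (hφ.stronglyMeasurable.integral_kernel_prod_right' (κ := K₁)).measurable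
    have hsec : ∀ h, Measurable fun y => φ (h, y) := fun h => hφ.comp measurable_prodMk_left
    have hsec' : ∀ h y, φ (h, y) ∈ Set.Icc (0 : ℝ) 1 := fun h y => hφ' (h, y)
    have hcsec : ∀ h, Measurable fun y => 1 - φ (h, y) := fun h => measurable_const.sub (hsec h)
    have hcsec' : ∀ h y, 1 - φ (h, y) ∈ Set.Icc (0 : ℝ) 1 := fun h y =>
      ⟨by linarith [(hsec' h y).2], by linarith [(hsec' h y).1]⟩
    obtain ⟨c, d, c', d', hcd⟩ := exists_eq_randomizedResponse hε
    have key : ∀ h, _ := fun h => hcd (U h) (V h) (integral_mem_Icc (hsec h) (hsec' h))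
      ((hM h).integral_le (hadj h) (hsec h) (hsec' h))
      ((hM h).integral_le (hsymm _ _ (hadj h)) (hsec h) (hsec' h))
      (by
        have := (hM h).integral_le (hadj h) (hcsec h) (hcsec' h)
        rwa [integral_one_sub (hsec h) (hsec' h), integral_one_sub (hsec h) (hsec' h)] at this)
      (by
        have := (hM h).integral_le (hsymm _ _ (hadj h)) (hcsec h) (hcsec' h)
        rwa [integral_one_sub (hsec h) (hsec' h), integral_one_sub (hsec h) (hsec' h)] at this)
    have hsm : Measurable fun h => c * U h + d * V h := by fun_prop
    have htm : Measurable fun h => c' * U h + d' * V h := by fun_prop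
    have hs := fun h => (key h).1
    have ht := fun h => (key h).2.1
    rw [Measure.integral_compProd (integrable_of_mem_Icc hφ hφ'),
      Measure.integral_compProd (integrable_of_mem_Icc hφ hφ')]
    have hlin : ∀ (P : Measure H) [IsProbabilityMeasure P] (p q : ℝ),
        ∫ h, (p * (c * U h + d * V h) + q * (c' * U h + d' * V h)) ∂P =
          p * ∫ h, (c * U h + d * V h) ∂P + q * ∫ h, (c' * U h + d' * V h) ∂P := by
      intro P _ p q
      rw [integral_add ((integrable_of_mem_Icc hsm hs).const_mul p)
        ((integrable_of_mem_Icc htm ht).const_mul q), integral_const_mul, integral_const_mul]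
    have hUI : ∫ h, U h ∂P₀ = _ :=
      (integral_congr_ae (.of_forall fun h => (key h).2.2.1)).trans (hlin P₀ _ _)
    have hVI : ∫ h, V h ∂P₁ = _ :=
      (integral_congr_ae (.of_forall fun h => (key h).2.2.2)).trans (hlin P₁ _ _)
    have hl' : ∀ ε ∈ l, 0 ≤ ε := fun ε h => hl ε (List.mem_cons_of_mem _ h)
    have i₁ := ih hl' hsm hs (γ := γ * Real.exp (-ε))
    have i₂ := ih hl' htm ht (γ := γ * Real.exp ε)
    change ∫ h, U h ∂P₀ - γ * ∫ h, V h ∂P₁ ≤ _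
    rw [hUI, hVI, rrHockeyStick]
    have he : 0 < Real.exp ε := Real.exp_pos ε
    refine le_trans (le_of_eq ?_) (add_le_add (mul_le_mul_of_nonneg_left i₁
      (div_nonneg he.le (by linarith))) (mul_le_mul_of_nonneg_left i₂
      (div_nonneg zero_le_one (by linarith))))
    rw [Real.exp_neg]
    field_simp
    ring

theorem IsAdaptiveComposition.privacyRegion_subset {𝒟 : Type v} [MeasurableSpace 𝒟]
    {adj : 𝒟 → 𝒟 → Prop} (hsymm : ∀ D D' : 𝒟, adj D D' → adj D' D) {l : List ℝ}
    {H : Type u} [mH : MeasurableSpace H]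
    {P₀ P₁ : Measure H} (h : IsAdaptiveComposition adj l H P₀ P₁) (hl : ∀ ε ∈ l, 0 ≤ ε) (ε : ℝ) :
    privacyRegion P₀ P₁ ⊆
      tradeOffRegion (dpTradeOff ε (rrHockeyStick l (Real.exp ε))) := by
  have := h.isProbabilityMeasure.1
  have := h.isProbabilityMeasure.2
  rintro ⟨t, β⟩ ⟨ht, hβ, hβ'⟩
  refine ⟨ht, le_trans ?_ hβ, hβ'⟩
  refine le_csInf ⟨1, fun _ => 0, measurable_const, fun _ => by simp, by simpa using ht.1,
    by simp⟩ ?_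
  rintro _ ⟨φ, hφ, hφ', hφt, rfl⟩
  have hcφ : Measurable fun ω => 1 - φ ω := measurable_const.sub hφ
  have hcφ' : ∀ ω, 1 - φ ω ∈ Set.Icc (0 : ℝ) 1 := fun ω =>
    ⟨by linarith [(hφ' ω).2], by linarith [(hφ' ω).1]⟩
  have h₁ := (h.symm hsymm).integral_sub_le hsymm hl hφ hφ' (γ := Real.exp ε)
  have h₂ := h.integral_sub_le hsymm hl hcφ hcφ' (γ := Real.exp ε)
  have h₃ := (integral_mem_Icc (μ := P₁) hcφ hcφ').1
  rw [integral_one_sub hφ hφ'] at h₂ h₃ ⊢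
  rw [integral_one_sub hφ hφ'] at h₂
  have he := Real.exp_pos ε
  refine max_le h₃ (max_le ?_ ?_)
  · have := mul_le_mul_of_nonneg_left hφt he.le
    dsimp only
    linarith
  · rw [Real.exp_neg, inv_mul_le_iff₀ he]
    dsimp only
    linarith

instance instFintypeRRView : (l : List ℝ) → Fintype (RRView l)
  | [] => inferInstanceAs (Fintype Unit)
  | _ :: l => @instFintypeProd (RRView l) Bool (instFintypeRRView l) _

instance instMeasurableSingletonClassRRView : (l : List ℝ) → MeasurableSingletonClass (RRView l)
  | [] => inferInstanceAs (MeasurableSingletonClass Unit)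
  | _ :: l =>
    have := instMeasurableSingletonClassRRView l
    inferInstanceAs (MeasurableSingletonClass (RRView l × Bool))

instance isProbabilityMeasure_randomizedResponse (ε : ℝ) (b : Bool) :
    IsProbabilityMeasure (randomizedResponse ε b) := by
  have he := Real.exp_pos ε
  constructor
  simp only [randomizedResponse, Measure.coe_add, Measure.coe_smul, Pi.add_apply, Pi.smul_apply,
    measure_univ, smul_eq_mul, mul_one]
  rw [← ENNReal.ofReal_add (by positivity) (by positivity), ← add_div,
    div_self (by positivity), ENNReal.ofReal_one]

instance isProbabilityMeasure_rrLaw (b : Bool) : (l : List ℝ) → IsProbabilityMeasure (rrLaw b l)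
  | [] => inferInstanceAs (IsProbabilityMeasure (Measure.dirac ()))
  | ε :: l =>
    have := isProbabilityMeasure_rrLaw b l
    inferInstanceAs (IsProbabilityMeasure ((rrLaw b l).prod (randomizedResponse ε b)))

/-- The probability of a view under independent randomized responses to the bit `b`. -/
noncomputable def rrWeight (b : Bool) (l : List ℝ) (ω : RRView l) : ℝ := (rrLaw b l).real {ω}

theorem rrWeight_nil (b : Bool) (ω : RRView []) : rrWeight b [] ω = 1 := by
  have h : (Measure.dirac ()).real {()} = 1 := by simp [measureReal_def]
  exact h

theorem randomizedResponse_real_singleton (ε : ℝ) (b c : Bool) :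
    (randomizedResponse ε b).real {c} =
      if b = c then Real.exp ε / (Real.exp ε + 1) else 1 / (Real.exp ε + 1) := by
  have he := Real.exp_pos ε
  have h₁ : 0 ≤ Real.exp ε / (Real.exp ε + 1) := by positivity
  have h₂ : 0 ≤ 1 / (Real.exp ε + 1) := by positivity
  rw [measureReal_def, randomizedResponse]
  cases b <;> cases c <;> simp [ENNReal.toReal_ofReal h₁] <;>
    simpa using h₂

theorem rrWeight_cons (b : Bool) (ε : ℝ) (l : List ℝ) (ω : RRView l) (c : Bool) :
    rrWeight b (ε :: l) (ω, c) = rrWeight b l ω *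
      if b = c then Real.exp ε / (Real.exp ε + 1) else 1 / (Real.exp ε + 1) := by
  rw [← randomizedResponse_real_singleton]
  change ((rrLaw b l).prod (randomizedResponse ε b)).real {(ω, c)} = _
  rw [← Set.singleton_prod_singleton, measureReal_prod_prod]
  rfl

theorem rrWeight_pos (b : Bool) (l : List ℝ) (ω : RRView l) : 0 < rrWeight b l ω := by
  induction l with
  | nil => rw [rrWeight_nil]; exact one_pos
  | cons ε l ih =>
    have he := Real.exp_pos ε
    rw [← Prod.mk.eta (p := ω), rrWeight_cons]
    refine mul_pos (ih _) ?_
    split_ifs <;> positivity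

theorem integral_rrLaw (b : Bool) (l : List ℝ) (φ : RRView l → ℝ) :
    ∫ ω, φ ω ∂(rrLaw b l) = ∑ ω, rrWeight b l ω * φ ω := by
  rw [integral_fintype Integrable.of_finite]
  rfl

theorem sum_rrWeight (b : Bool) (l : List ℝ) : ∑ ω, rrWeight b l ω = 1 := by
  have := integral_rrLaw b l fun _ => 1
  simpa using this.symm

theorem sum_max_sub_rrWeight (b : Bool) (l : List ℝ) (γ : ℝ) :
    ∑ ω, max 0 (rrWeight b l ω - γ * rrWeight (!b) l ω) = rrHockeyStick l γ := by
  induction l generalizing γ with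
  | nil =>
    simp only [rrWeight_nil, mul_one, rrHockeyStick]
    exact Fintype.sum_unique (ι := Unit) _
  | cons ε l ih =>
    have he := Real.exp_pos ε
    rw [rrHockeyStick, ← ih, ← ih, Finset.mul_sum, Finset.mul_sum]
    refine (Fintype.sum_prod_type (α₁ := RRView l) (α₂ := Bool) _).trans ?_
    rw [← Finset.sum_add_distrib]
    refine Finset.sum_congr rfl fun ω _ => ?_
    rw [mul_max_of_nonneg _ _ (by positivity), mul_max_of_nonneg _ _ (by positivity), mul_zero,
      mul_zero, Fintype.sum_bool]
    simp only [rrWeight_cons]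
    have h₁ : Real.exp ε / (Real.exp ε + 1) *
        (rrWeight b l ω - γ * Real.exp (-ε) * rrWeight (!b) l ω) =
        rrWeight b l ω * (Real.exp ε / (Real.exp ε + 1)) -
          γ * (rrWeight (!b) l ω * (1 / (Real.exp ε + 1))) := by
      rw [Real.exp_neg]
      field_simp
    have h₂ : 1 / (Real.exp ε + 1) *
        (rrWeight b l ω - γ * Real.exp ε * rrWeight (!b) l ω) =
        rrWeight b l ω * (1 / (Real.exp ε + 1)) -
          γ * (rrWeight (!b) l ω * (Real.exp ε / (Real.exp ε + 1))) := by
      ring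
    rw [h₁, h₂]
    cases b
    · simp [add_comm]
    · simp

/-- A most powerful test of a given size on a finite sample space, of likelihood-ratio form. -/
theorem exists_neymanPearson {Ω : Type*} [Fintype Ω] {w₀ w₁ : Ω → ℝ} (h₀ : ∀ ω, 0 < w₀ ω)
    (hs : ∑ ω, w₀ ω = 1) {t : ℝ} (ht : t ∈ Set.Icc (0 : ℝ) 1) :
    ∃ (ω₀ : Ω) (φ : Ω → ℝ), (∀ ω, φ ω ∈ Set.Icc (0 : ℝ) 1) ∧ ∑ ω, w₀ ω * φ ω = t ∧
      ∑ ω, w₁ ω * φ ω = w₁ ω₀ / w₀ ω₀ * t +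
        ∑ ω, max 0 (w₁ ω - w₁ ω₀ / w₀ ω₀ * w₀ ω) := by
  classical
  set L : Ω → ℝ := fun ω => w₁ ω / w₀ ω with hL
  let A : Ω → ℝ := fun ω₀ => ∑ ω, if L ω₀ < L ω then w₀ ω else 0
  have hne : Nonempty Ω := by
    by_contra h
    rw [not_nonempty_iff] at h
    simp at hs
  obtain ⟨m, -, hm⟩ := Finset.exists_max_image Finset.univ L Finset.univ_nonempty
  have hAm : A m ≤ t := by
    have : A m = 0 := Finset.sum_eq_zero fun ω hω => if_neg (not_lt.2 (hm ω hω))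
    exact this.trans_le ht.1
  obtain ⟨ω₀, hω₀, hmin⟩ := Finset.exists_min_image (Finset.univ.filter fun ω => A ω ≤ t) L
    ⟨m, by simpa using hAm⟩
  have hA : A ω₀ ≤ t := (Finset.mem_filter.1 hω₀).2
  let B : ℝ := ∑ ω, if L ω = L ω₀ then w₀ ω else 0
  have hB : 0 < B := by
    refine Finset.sum_pos' (fun ω _ => ?_) ⟨ω₀, Finset.mem_univ _, ?_⟩
    · split_ifs
      exacts [(h₀ ω).le, le_rfl]
    · rw [if_pos rfl]
      exact h₀ ω₀
  have hAB : t ≤ A ω₀ + B := by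
    by_contra! hlt
    have hsum : A ω₀ + B = ∑ ω, if L ω₀ ≤ L ω then w₀ ω else 0 := by
      rw [← Finset.sum_add_distrib]
      refine Finset.sum_congr rfl fun ω _ => ?_
      rcases lt_trichotomy (L ω₀) (L ω) with h | h | h
      · rw [if_pos h, if_neg h.ne', if_pos h.le, add_zero]
      · rw [if_neg h.not_lt, if_pos h.symm, if_pos h.le, zero_add]
      · rw [if_neg h.not_gt, if_neg h.ne, if_neg (not_le.2 h), add_zero]
    by_cases hlow : ∃ ω, L ω < L ω₀
    · obtain ⟨ω₁, hω₁, hmax⟩ := Finset.exists_max_image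
        (Finset.univ.filter fun ω => L ω < L ω₀) L (by simpa [Finset.Nonempty] using hlow)
      have hω₁' : L ω₁ < L ω₀ := (Finset.mem_filter.1 hω₁).2
      have hA₁ : A ω₁ = A ω₀ + B := by
        rw [hsum]
        refine Finset.sum_congr rfl fun ω _ => ?_
        congr 1
        refine propext ⟨fun h => ?_, fun h => hω₁'.trans_le h⟩
        by_contra! h'
        exact (hmax ω (by simpa using h')).not_gt h
      exact (hmin ω₁ (by simpa [hA₁] using hlt.le)).not_gt hω₁'
    · push Not at hlow
      have : A ω₀ + B = 1 := by
        rw [hsum, ← hs]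
        exact Finset.sum_congr rfl fun ω _ => if_pos (hlow ω)
      linarith [ht.2]
  let φ : Ω → ℝ := fun ω =>
    if L ω₀ < L ω then 1 else if L ω = L ω₀ then (t - A ω₀) / B else 0
  have hsize : ∑ ω, w₀ ω * φ ω = t := by
    have : ∀ ω, w₀ ω * φ ω = (if L ω₀ < L ω then w₀ ω else 0) +
          (t - A ω₀) / B * (if L ω = L ω₀ then w₀ ω else 0) := by
      intro ω
      rcases lt_trichotomy (L ω₀) (L ω) with h | h | h
      · simp [φ, h, h.ne']
      · simp [φ, h, mul_comm]
      · simp [φ, h.not_gt, h.ne]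
    simp_rw [this]
    rw [Finset.sum_add_distrib, ← Finset.mul_sum]
    change A ω₀ + (t - A ω₀) / B * B = t
    rw [div_mul_cancel₀ _ hB.ne']
    ring
  refine ⟨ω₀, φ, fun ω => ?_, hsize, ?_⟩
  · dsimp only [φ]
    split_ifs
    · simp
    · exact ⟨div_nonneg (by linarith) hB.le, (div_le_one hB).2 (by linarith)⟩
    · simp
  · change _ = L ω₀ * t + ∑ ω, max 0 (w₁ ω - L ω₀ * w₀ ω)
    rw [← hsize, Finset.mul_sum, ← Finset.sum_add_distrib]
    refine Finset.sum_congr rfl fun ω _ => ?_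
    have hw : w₁ ω = L ω * w₀ ω := (div_mul_cancel₀ _ (h₀ ω).ne').symm
    rw [hw, ← sub_mul]
    rcases lt_trichotomy (L ω₀) (L ω) with h | h | h
    · rw [max_eq_right (mul_nonneg (sub_nonneg.2 h.le) (h₀ ω).le)]
      simp only [φ, if_pos h]
      ring
    · rw [h]
      simp [mul_assoc]
    · rw [max_eq_left (mul_nonpos_of_nonpos_of_nonneg (sub_nonpos.2 h.le) (h₀ ω).le)]
      simp [φ, h.not_gt, h.ne]

theorem IsAdaptiveComposition.privacyRegion_subset_hetRegion {𝒟 : Type v} [MeasurableSpace 𝒟]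
    {adj : 𝒟 → 𝒟 → Prop} (hsymm : ∀ D D' : 𝒟, adj D D' → adj D' D) {ε₁ ε₂ : ℝ} (hε₁ : 0 < ε₁)
    {x y : ℕ} {l : List ℝ} (hl : l.Perm (List.replicate x ε₁ ++ List.replicate y ε₂))
    (hl₀ : ∀ ε ∈ l, 0 ≤ ε) {H : Type u} [mH : MeasurableSpace H] {P₀ P₁ : Measure H}
    (h : IsAdaptiveComposition adj l H P₀ P₁) :
    privacyRegion P₀ P₁ ⊆ hetRegion ε₁ ε₂ x y := by
  refine Set.subset_iInter₂ fun q _ => ?_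
  rw [← rrHockeyStick_hetEps hε₁, ← rrHockeyStick_perm hl]
  exact h.privacyRegion_subset hsymm hl₀ _

/-- The values `∑ ± ε` over the levels `ε` of the list. -/
def signedSums : List ℝ → Set ℝ
  | [] => {0}
  | ε :: l => {s | ∃ s' ∈ signedSums l, s = s' + ε ∨ s = s' - ε}

theorem signedSums_perm {l l' : List ℝ} (h : l.Perm l') : signedSums l = signedSums l' := by
  have key : ∀ (ε ε' : ℝ) (l : List ℝ),
      signedSums (ε :: ε' :: l) ⊆ signedSums (ε' :: ε :: l) := by
    rintro ε ε' l _ ⟨_, ⟨s, hs, rfl | rfl⟩, rfl | rfl⟩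
    · exact ⟨s + ε, ⟨s, hs, .inl rfl⟩, .inl (by ring)⟩
    · exact ⟨s - ε, ⟨s, hs, .inr rfl⟩, .inl (by ring)⟩
    · exact ⟨s + ε, ⟨s, hs, .inl rfl⟩, .inr (by ring)⟩
    · exact ⟨s - ε, ⟨s, hs, .inr rfl⟩, .inr (by ring)⟩
  induction h with
  | nil => rfl
  | cons ε _ ih => simp only [signedSums, ih]
  | swap ε ε' l => exact (key _ _ _).antisymm (key _ _ _)
  | trans _ _ ih₁ ih₂ => exact ih₁.trans ih₂

theorem exists_of_mem_signedSums_replicate_append {n : ℕ} {ε : ℝ} {l : List ℝ} {s : ℝ}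
    (hs : s ∈ signedSums (List.replicate n ε ++ l)) :
    ∃ a ≤ n, ∃ s' ∈ signedSums l, s = ε * ((n : ℝ) - 2 * a) + s' := by
  induction n generalizing s with
  | zero => exact ⟨0, le_rfl, s, by simpa using hs, by simp⟩
  | succ n ih =>
    obtain ⟨r, hr, h⟩ := hs
    obtain ⟨a, ha, s', hs', rfl⟩ := ih hr
    rcases h with rfl | rfl
    · exact ⟨a, by lia, s', hs', by push_cast; ring⟩
    · exact ⟨a + 1, by lia, s', hs', by push_cast; ring⟩

theorem exists_hetEps_of_mem_signedSums {ε₁ ε₂ : ℝ} {x y : ℕ} {s : ℝ}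
    (hs : s ∈ signedSums (List.replicate x ε₁ ++ List.replicate y ε₂)) :
    ∃ a ≤ x, ∃ b ≤ y, s = hetEps ε₁ ε₂ x y a b := by
  obtain ⟨a, ha, r, hr, rfl⟩ := exists_of_mem_signedSums_replicate_append hs
  rw [← List.append_nil (List.replicate y ε₂)] at hr
  obtain ⟨b, hb, _, rfl, rfl⟩ := exists_of_mem_signedSums_replicate_append hr
  exact ⟨a, ha, b, hb, by rw [hetEps, add_zero]⟩

theorem exists_rrWeight_eq_exp_mul (l : List ℝ) (ω : RRView l) :
    ∃ s ∈ signedSums l, rrWeight true l ω = Real.exp s * rrWeight false l ω := by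
  induction l with
  | nil => exact ⟨0, rfl, by simp [rrWeight_nil]⟩
  | cons ε l ih =>
    obtain ⟨ω, c⟩ := ω
    obtain ⟨s, hs, h⟩ := ih ω
    rw [rrWeight_cons, rrWeight_cons, h]
    have he := Real.exp_pos ε
    cases c
    · refine ⟨s - ε, ⟨s, hs, .inr rfl⟩, ?_⟩
      rw [sub_eq_add_neg, Real.exp_add, Real.exp_neg]
      simp
      field_simp
    · refine ⟨s + ε, ⟨s, hs, .inl rfl⟩, ?_⟩
      rw [Real.exp_add]
      simp
      ring

theorem rrHockeyStick_inv (l : List ℝ) {γ : ℝ} (hγ : 0 < γ) :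
    γ * rrHockeyStick l γ⁻¹ = rrHockeyStick l γ - 1 + γ := by
  rw [← sum_max_sub_rrWeight false, ← sum_max_sub_rrWeight true, Finset.mul_sum]
  have : ∑ ω, (rrWeight true l ω - γ * rrWeight false l ω) = 1 - γ := by
    rw [Finset.sum_sub_distrib, ← Finset.mul_sum, sum_rrWeight, sum_rrWeight, mul_one]
  rw [sub_add, ← this, ← Finset.sum_sub_distrib]
  refine Finset.sum_congr rfl fun ω _ => ?_
  rw [mul_max_of_nonneg _ _ hγ.le, mul_zero, mul_sub, mul_inv_cancel_left₀ hγ.ne']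
  simp only [Bool.not_true, Bool.not_false]
  rw [← max_sub_sub_right, zero_sub, neg_sub, sub_self, max_comm]

theorem randomizedResponse_le {ε : ℝ} (hε : 0 ≤ ε) (b c : Bool) :
    randomizedResponse ε b ≤ ENNReal.ofReal (Real.exp ε) • randomizedResponse ε c := by
  have he := Real.exp_pos ε
  have h1 : 1 ≤ Real.exp ε := Real.one_le_exp hε
  refine Measure.le_iff.2 fun S _ => ?_
  by_cases h : b = c
  · subst h
    rw [Measure.smul_apply, smul_eq_mul]
    exact le_mul_of_one_le_left' (by rwa [ENNReal.one_le_ofReal])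
  · obtain rfl : c = !b := by cases b <;> cases c <;> simp_all
    simp only [randomizedResponse, Bool.not_not, Measure.coe_smul, Measure.coe_add,
      Pi.add_apply, Pi.smul_apply, smul_eq_mul, mul_add]
    rw [add_comm (ENNReal.ofReal (Real.exp ε) * _), ← mul_assoc, ← mul_assoc,
      ← ENNReal.ofReal_mul he.le, ← ENNReal.ofReal_mul he.le]
    gcongr
    · rw [mul_one_div]
    · rw [← mul_div_assoc]
      gcongr
      nlinarith

theorem isAdaptiveComposition_rrLaw {𝒟 : Type v} [MeasurableSpace 𝒟]
    [MeasurableSingletonClass 𝒟] {adj : 𝒟 → 𝒟 → Prop} {D₀ D₁ : 𝒟} (hadj : adj D₀ D₁)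
    (hne : D₀ ≠ D₁) : (l : List ℝ) → (∀ ε ∈ l, 0 ≤ ε) →
    IsAdaptiveComposition adj l (RRView l) (rrLaw false l) (rrLaw true l)
  | [], _ => .start Unit (Measure.dirac ())
  | ε :: l, hl => by
    classical
    have hS : MeasurableSet {p : RRView l × 𝒟 | p.2 = D₀} :=
      measurable_snd (measurableSet_singleton D₀)
    let M : Kernel (RRView l × 𝒟) Bool := Kernel.piecewise hS
      (Kernel.const _ (randomizedResponse ε false)) (Kernel.const _ (randomizedResponse ε true))
    have hM : ∀ p, M p = randomizedResponse ε (if p.2 = D₀ then false else true) := by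
      intro p
      by_cases h : p.2 = D₀ <;> simp [M, Kernel.piecewise_apply, h]
    have hcomp := IsAdaptiveComposition.round l ε (RRView l) (rrLaw false l) (rrLaw true l)
      (isAdaptiveComposition_rrLaw hadj hne l fun ε h => hl ε (List.mem_cons_of_mem _ h))
      Bool M (fun h D D' _ S _ => by
        dsimp only
        rw [hM, hM, ENNReal.ofReal_zero, add_zero]
        exact randomizedResponse_le (hl ε List.mem_cons_self) _ _ S)
      (fun _ => D₀) (fun _ => D₁) measurable_const measurable_const fun _ => hadj
    have h₀ : M.comap (fun h => (h, D₀)) (measurable_id.prodMk measurable_const) =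
        Kernel.const _ (randomizedResponse ε false) := by
      ext1 h
      rw [Kernel.comap_apply, hM, Kernel.const_apply, if_pos rfl]
    have h₁ : M.comap (fun h => (h, D₁)) (measurable_id.prodMk measurable_const) =
        Kernel.const _ (randomizedResponse ε true) := by
      ext1 h
      rw [Kernel.comap_apply, hM, Kernel.const_apply, if_neg hne.symm]
    rw [h₀, h₁, Measure.compProd_const, Measure.compProd_const] at hcomp
    exact hcomp

theorem hetRegion_subset_privacyRegion_rrLaw {ε₁ ε₂ : ℝ} (hε₁ : 0 < ε₁) {x y : ℕ} {l : List ℝ}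
    (hl : l.Perm (List.replicate x ε₁ ++ List.replicate y ε₂)) :
    hetRegion ε₁ ε₂ x y ⊆ privacyRegion (rrLaw false l) (rrLaw true l) := by
  rintro ⟨t, β⟩ hp
  have hp' : ∀ a ≤ x, ∀ b ≤ y, 0 ≤ hetEps ε₁ ε₂ x y a b → (t, β) ∈
      tradeOffRegion (dpTradeOff (hetEps ε₁ ε₂ x y a b)
        (rrHockeyStick l (Real.exp (hetEps ε₁ ε₂ x y a b)))) := by
    intro a ha b hb h
    rw [rrHockeyStick_perm hl, rrHockeyStick_hetEps hε₁]
    exact Set.mem_iInter₂.1 hp (a, b) ⟨ha, hb, h⟩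
  have hneg : ∀ a ≤ x, ∀ b ≤ y,
      hetEps ε₁ ε₂ x y (x - a) (y - b) = -hetEps ε₁ ε₂ x y a b := by
    intro a ha b hb
    rw [hetEps, hetEps, Nat.cast_sub ha, Nat.cast_sub hb]
    ring
  have htβ : t ∈ Set.Icc (0 : ℝ) 1 ∧ β ≤ 1 - t := by
    rcases le_total 0 (hetEps ε₁ ε₂ x y 0 0) with h | h
    · have := hp' 0 (Nat.zero_le _) 0 (Nat.zero_le _) h
      exact ⟨this.1, this.2.2⟩
    · have := hp' x le_rfl y le_rfl (by
        have := hneg 0 (Nat.zero_le _) 0 (Nat.zero_le _)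
        rw [Nat.sub_zero, Nat.sub_zero] at this
        linarith)
      exact ⟨this.1, this.2.2⟩
  refine ⟨htβ.1, ?_, htβ.2⟩
  obtain ⟨ω₀, φ, hφ, hsize, hpow⟩ := exists_neymanPearson (w₀ := rrWeight false l)
    (w₁ := rrWeight true l) (rrWeight_pos false l) (sum_rrWeight false l) htβ.1
  obtain ⟨s, hs, hω₀⟩ := exists_rrWeight_eq_exp_mul l ω₀
  rw [signedSums_perm hl] at hs
  obtain ⟨a, ha, b, hb, rfl⟩ := exists_hetEps_of_mem_signedSums hs
  have hφm : Measurable φ := measurable_of_finite φ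
  have htest : tradeOff (rrLaw false l) (rrLaw true l) t ≤ ∫ ω, (1 - φ ω) ∂(rrLaw true l) := by
    refine csInf_le ⟨0, ?_⟩ ⟨φ, hφm, hφ, ?_, rfl⟩
    · rintro _ ⟨ψ, -, hψ, -, rfl⟩
      exact integral_nonneg fun ω => sub_nonneg.2 (hψ ω).2
    · rw [integral_rrLaw, hsize]
  refine htest.trans ?_
  have hE := sum_max_sub_rrWeight true l (Real.exp (hetEps ε₁ ε₂ x y a b))
  rw [Bool.not_true] at hE
  rw [integral_one_sub hφm hφ, integral_rrLaw, hpow, hω₀,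
    mul_div_cancel_right₀ _ (rrWeight_pos false l ω₀).ne', hE]
  rcases le_total 0 (hetEps ε₁ ε₂ x y a b) with h | h
  · have := (le_max_left _ _).trans ((le_max_right _ _).trans (hp' a ha b hb h).2.1)
    dsimp only at this ⊢
    linarith
  · have := (le_max_right _ _).trans ((le_max_right _ _).trans
      (hp' (x - a) (Nat.sub_le _ _) (y - b) (Nat.sub_le _ _) (by
        rw [hneg a ha b hb]
        linarith)).2.1)
    dsimp only at this ⊢
    rw [hneg a ha b hb, neg_neg, Real.exp_neg] at this
    have hinv := rrHockeyStick_inv l (Real.exp_pos (hetEps ε₁ ε₂ x y a b))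
    linarith

end HetDP

theorem mainTheorem3 {𝒟 : Type v} [MeasurableSpace 𝒟] [MeasurableSingletonClass 𝒟]
    (adj : 𝒟 → 𝒟 → Prop) (hsymm : ∀ D D' : 𝒟, adj D D' → adj D' D)
    (hadj : ∃ D D' : 𝒟, adj D D' ∧ D ≠ D')
    (ε₁ ε₂ : ℝ) (hε₁ : 0 < ε₁) (hε₂ : 0 ≤ ε₂) (x y : ℕ)
    (l : List ℝ) (hl : l.Perm (List.replicate x ε₁ ++ List.replicate y ε₂)) :
    -- the privacy region of the composition is given by the explicit slopes and offsets
    HetDP.compositionRegion adj l = HetDP.hetRegion ε₁ ε₂ x y ∧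
    -- no composition, with outputs in any universe, exceeds that region
    (∀ (H : Type u) [MeasurableSpace H] (P₀ P₁ : Measure H),
      HetDP.IsAdaptiveComposition adj l H P₀ P₁ →
        HetDP.privacyRegion P₀ P₁ ⊆ HetDP.hetRegion ε₁ ε₂ x y) ∧
    -- the composition of binary randomized responses attains all of it
    (HetDP.IsAdaptiveComposition adj l (HetDP.RRView l)
        (HetDP.rrLaw false l) (HetDP.rrLaw true l) ∧
      HetDP.privacyRegion (HetDP.rrLaw false l) (HetDP.rrLaw true l) =
        HetDP.hetRegion ε₁ ε₂ x y) := by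
  have hl₀ : ∀ ε ∈ l, 0 ≤ ε := by
    intro ε hε
    rcases List.mem_append.1 (hl.mem_iff.1 hε) with h | h
    · exact (List.eq_of_mem_replicate h).symm ▸ hε₁.le
    · exact (List.eq_of_mem_replicate h).symm ▸ hε₂
  obtain ⟨D₀, D₁, hD, hne⟩ := hadj
  have hrr := HetDP.isAdaptiveComposition_rrLaw hD hne l hl₀
  have hsup := HetDP.hetRegion_subset_privacyRegion_rrLaw hε₁ hl
  have hsub := hrr.privacyRegion_subset_hetRegion hsymm hε₁ hl hl₀
  refine ⟨Set.Subset.antisymm ?_ fun p hp => ⟨_, _, _, _, hrr, hsup hp⟩, fun H _ P₀ P₁ h =>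
    h.privacyRegion_subset_hetRegion hsymm hε₁ hl hl₀, hrr, hsub.antisymm hsup⟩
  rintro p ⟨H, _, P₀, P₁, h, hp⟩
  exact h.privacyRegion_subset_hetRegion hsymm hε₁ hl hl₀ hp
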